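/- For $n\ge 1$ let $\mathcal G_{2\times n}$ be the grid graph with vertices $a_1,\dots,a_n,b_1,\dots,b_n$ and edges $a_ia_{i+1}$, $b_ib_{i+1}$ $(1\le i\le n-1)$ and $a_jb_j$ $(1\le j\le n)$. For a finite graph $G$ and $k\ge 1$, the $k$-cut complex $\Delta_k(G)$ is the simplicial complex on the vertex set $V(G)$ in which $\sigma$ is a face if and only if $V(G)\setminus\sigma$ contains a $k$-element set $S$ such that the induced subgraph $G[S]$ is disconnected; its facets are the complements of such sets $S$. **Theorem.** For all $n$ and $k$ with $3\le k\le 2n-2$, the complex $\Delta_k(\mathcal G_{2\times n})$ is shellable, in both of the following senses. 1. Its facets can be listed without repetition as $F_1,\dots,F_t$ such that for all $2\le j\le t$ the complex $\bigl(\bigcup_{s<j}\langle F_s\rangle\bigr)\cap\langle F_j\rangle$ is pure of dimension $\dim\langle F_j\rangle-1$, where $\langle F\rangle$ denotes the complex of all subsets of $F$. 2. It belongs to the smallest class of simplicial complexes that contains every simplex $\langle F\rangle$ and contains every pure complex $\mathcal K$ that has a vertex $v$ such that every facet of the deletion $\mathrm{del}_{\mathcal K}(v)=\{\tau\in\mathcal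 K: v\notin\tau\}$ is a facet of $\mathcal K$ and such that $\mathrm{del}_{\mathcal K}(v)$ and the link $\mathrm{lk}_{\mathcal K}(v)=\{\tau\in\mathcal K: v\notin\tau,\ \tau\cup\{v\}\in\mathcal K\}$ both belong to the class. -/

import Mathlib

namespace GridCut

/-- A simplicial complex with vertices in `V`: a collection of finite sets closed under taking
subsets. The empty simplex is a face of every complex except the void complex `⊥`; unions and
intersections of complexes are `⊔` and `⊓`; the complex generated by the single facet `F` is
`LowerSet.Iic F`. -/
abbrev Complex (V : Type*) := LowerSet (Finset V)

namespace Complex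

variable {V : Type*}

/-- `σ` is a facet of `K`: an inclusion-maximal face. -/
def IsFacet (K : Complex V) (σ : Finset V) : Prop := Maximal (· ∈ K) σ

/-- `K` is pure: all its facets have the same dimension. -/
def IsPure (K : Complex V) : Prop :=
  ∀ σ τ, K.IsFacet σ → K.IsFacet τ → σ.card = τ.card

/-- `K` has dimension `d`: the maximum of `|σ| - 1` over the faces `σ` exists and equals `d`.
The void complex has no dimension, and the complex `{∅}` has dimension `-1`. -/
def HasDim (K : Complex V) (d : ℤ) : Prop :=
  IsGreatest {e : ℤ | ∃ σ ∈ K, e = (σ.card : ℤ) - 1} d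

/-- `F 0, F 1, …, F (t - 1)` is a shelling order of `K`: it lists the facets of `K` without
repetition, and for every `j` other than the first, the subcomplex `(⋃ s < j, ⟨F s⟩) ∩ ⟨F j⟩` is
pure of dimension `dim ⟨F j⟩ - 1`, where `dim ⟨F j⟩ = |F j| - 1`. -/
def IsShellingOrder (K : Complex V) {t : ℕ} (F : Fin t → Finset V) : Prop :=
  Function.Injective F ∧ (∀ σ, K.IsFacet σ ↔ ∃ i, F i = σ) ∧
    ∀ j : Fin t, 0 < (j : ℕ) →
      IsPure ((⨆ s : {s : Fin t // s < j}, LowerSet.Iic (F s)) ⊓ LowerSet.Iic (F j)) ∧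
      HasDim ((⨆ s : {s : Fin t // s < j}, LowerSet.Iic (F s)) ⊓ LowerSet.Iic (F j))
        (((F j).card : ℤ) - 1 - 1)

/-- `K` is shellable: it has finitely many facets and they admit a shelling order. -/
def IsShellable (K : Complex V) : Prop :=
  ∃ (t : ℕ) (F : Fin t → Finset V), K.IsShellingOrder F

/-- The deletion of the vertex `v`: the faces of `K` that do not contain `v`. -/
def deletion (K : Complex V) (v : V) : Complex V where
  carrier := {τ | τ ∈ K ∧ v ∉ τ}
  lower' := fun _ _ hba ha => ⟨K.lower hba ha.1, fun hv => ha.2 (hba hv)⟩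

variable [DecidableEq V]

/-- The link of the vertex `v`: the faces `τ` of `K` with `v ∉ τ` and `τ ∪ {v} ∈ K`. -/
def link (K : Complex V) (v : V) : Complex V where
  carrier := {τ | τ ∈ K ∧ v ∉ τ ∧ insert v τ ∈ K}
  lower' := fun _ _ hba ha => ⟨K.lower hba ha.1, fun hv => ha.2.1 (hba hv),
    K.lower (Finset.insert_subset_insert v hba) ha.2.2⟩

/-- `v` is a shedding vertex of `K`: it is a vertex of `K`, and every facet of the deletion of `v`
is a facet of `K`. -/
def IsSheddingVertex (K : Complex V) (v : V) : Prop :=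
  {v} ∈ K ∧ ∀ σ, (K.deletion v).IsFacet σ → K.IsFacet σ

/-- The recursively defined class: every simplex belongs to it, and so does every pure complex
with a shedding vertex whose link and deletion belong to it. -/
inductive IsRecursivelyShellable : Complex V → Prop
  | simplex (F : Finset V) : IsRecursivelyShellable (LowerSet.Iic F)
  | shed (K : Complex V) (v : V) (pure : K.IsPure) (shedding : K.IsSheddingVertex v)
      (link : IsRecursivelyShellable (K.link v))
      (deletion : IsRecursivelyShellable (K.deletion v)) : IsRecursivelyShellable K

end Complex

/-- The `k`-cut complex of a finite graph `G` (for `k ≥ 1`): `σ` is a face if and only if its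
complement contains a set `S` of `k` vertices such that the induced subgraph `G[S]` is
disconnected. Its facets are thus the complements of such sets `S`. -/
def cutComplex {V : Type*} [Fintype V] [DecidableEq V] (G : SimpleGraph V) (k : ℕ) :
    Complex V where
  carrier := {σ | ∃ S : Finset V, S ⊆ σᶜ ∧ S.card = k ∧ ¬ (G.induce (S : Set V)).Preconnected}
  lower' := fun _ _ hba ⟨S, hS, h⟩ => ⟨S, hS.trans (Finset.compl_subset_compl.2 hba), h⟩

/-- The `2 × n` grid graph: the vertices `a_i` and `b_i` are `(0, i)` and `(1, i)`, and two
vertices are adjacent when they agree in one coordinate and are consecutive in the other one. -/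
def grid (n : ℕ) : SimpleGraph (Fin 2 × Fin n) :=
  (SimpleGraph.pathGraph 2).boxProd (SimpleGraph.pathGraph n)

end GridCut

/-!
The facets of the `k`-cut complex are the complements of the `k`-element vertex sets that induce a
disconnected subgraph, and everything is phrased through the family of these sets. Taking the link
of a vertex `v` keeps the sets avoiding `v`; taking the deletion keeps the sets containing `v`,
provided that `v` can be exchanged into every set avoiding it, which is the shedding condition.
`ExchangeDecomposable` is the resulting recursion on set families. It yields the recursive class
(`ExchangeDecomposable.isRecursivelyShellable`), and, by listing the sets containing `v` before
those avoiding `v` at every split, a shelling order (`ExchangeDecomposable.isShellable`).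

For the grid, the vertices are decided column by column. A state consists of a set `I` of chosen
vertices in the columns before `m`, all undecided vertices lying in column `m` or beyond.

* If `I` is joined to the undecided vertices through at most one vertex `c`, every choice avoiding
  `c` is disconnected, so that any member containing `c` may exchange `c` for any other vertex.
  Splitting at `c` last therefore works (`exchangeDecomposable_of_pivot`,
  `exchangeDecomposable_of_single_row`).
* Otherwise `I` contains both vertices of column `m - 1`. If at least three vertices remain to be
  chosen, then column `m` can be decided next: when adding a vertex `v` of this column connects the
  set, the right-hand neighbour of `v` can be given up, because column `m + 1` then offers no
  passage any more (`exchangeDecomposable_of_both_rows`). For exactly two remaining vertices this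
  fails, and two vertices in columns `m` and `m + 1` are decided in another order
  (`exchangeDecomposable_of_card_eq_add_two`).
* While nothing has been chosen, `v` is a corner of the remaining grid, and the same exchange works
  because `3 ≤ k` (`exchangeDecomposable_of_columns`).

The bound `k ≤ 2 n - 2` makes the complex nonvoid, since a corner has only two neighbours.
-/

namespace GridCut

open Finset

/-! ### Set families with an exchange property -/

section Decomposable

variable {V : Type*}

variable [DecidableEq V] in
/-- Families of finite sets, thought of as the complements of the facets of a complex, that can
be taken apart by splitting them at one element after the other. Splitting at `v` is allowed when
every member avoiding `v` can be turned into a member containing `v` by an exchange, unless no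
member contains `v` at all. In the complex, the members containing `v` give the facets of the
deletion of `v`, and those avoiding `v` give the facets of the link. -/
inductive ExchangeDecomposable : Finset (Finset V) → Prop
  | subsingleton (𝒮 : Finset (Finset V)) (h : ∀ S ∈ 𝒮, ∀ T ∈ 𝒮, S = T) : ExchangeDecomposable 𝒮
  | split (𝒮 : Finset (Finset V)) (v : V)
      (exchange : ∀ S ∈ 𝒮, v ∉ S → (∃ T ∈ 𝒮, v ∈ T) → ∃ T ∈ 𝒮, v ∈ T ∧ T ⊆ insert v S)
      (mem : ExchangeDecomposable {S ∈ 𝒮 | v ∈ S})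
      (notMem : ExchangeDecomposable {S ∈ 𝒮 | v ∉ S}) : ExchangeDecomposable 𝒮

/-- The complex on the ground set `U` whose faces are the subsets of `U` that miss some member of
the family `𝒮`. The members of `𝒮` need not be contained in `U`. -/
def avoidingComplex (U : Finset V) (𝒮 : Finset (Finset V)) : Complex V where
  carrier := {σ | σ ⊆ U ∧ ∃ S ∈ 𝒮, Disjoint σ S}
  lower' := fun _ _ hba ⟨hU, S, hS, hd⟩ => ⟨hba.trans hU, S, hS, hd.mono_left hba⟩

theorem mem_avoidingComplex {U : Finset V} {𝒮 : Finset (Finset V)} {σ : Finset V} :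
    σ ∈ avoidingComplex U 𝒮 ↔ σ ⊆ U ∧ ∃ S ∈ 𝒮, Disjoint σ S := Iff.rfl

variable [DecidableEq V]

theorem isFacet_avoidingComplex {U : Finset V} {𝒮 : Finset (Finset V)}
    (hc : ∀ S ∈ 𝒮, ∀ T ∈ 𝒮, (U \ S).card = (U \ T).card) (σ : Finset V) :
    (avoidingComplex U 𝒮).IsFacet σ ↔ ∃ S ∈ 𝒮, U \ S = σ := by
  constructor
  · rintro ⟨⟨hU, S, hS, hd⟩, hmax⟩
    have hle : σ ⊆ U \ S := subset_sdiff.2 ⟨hU, hd⟩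
    exact ⟨S, hS, (hmax (mem_avoidingComplex.2 ⟨sdiff_subset, S, hS, sdiff_disjoint⟩) hle).antisymm
      hle⟩
  · rintro ⟨S, hS, rfl⟩
    refine ⟨mem_avoidingComplex.2 ⟨sdiff_subset, S, hS, sdiff_disjoint⟩, ?_⟩
    rintro τ ⟨hU, T, hT, hd⟩ hle
    have h1 : τ ⊆ U \ T := subset_sdiff.2 ⟨hU, hd⟩
    have h2 : U \ S = τ := eq_of_subset_of_card_le hle ((card_le_card h1).trans (hc T hT S hS).le)
    exact h2.ge

theorem avoidingComplex_isPure {U : Finset V} {𝒮 : Finset (Finset V)}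
    (hc : ∀ S ∈ 𝒮, ∀ T ∈ 𝒮, (U \ S).card = (U \ T).card) : (avoidingComplex U 𝒮).IsPure := by
  intro σ τ hσ hτ
  obtain ⟨S, hS, rfl⟩ := (isFacet_avoidingComplex hc σ).1 hσ
  obtain ⟨T, hT, rfl⟩ := (isFacet_avoidingComplex hc τ).1 hτ
  exact hc S hS T hT

/-- All members of `𝒮` are required to agree outside `U`, so that an element at which the family
is properly split is a vertex of the complex. -/
theorem ExchangeDecomposable.isRecursivelyShellable {𝒮 : Finset (Finset V)}
    (h : ExchangeDecomposable 𝒮) (U : Finset V) (hne : 𝒮.Nonempty)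
    (hc : ∀ S ∈ 𝒮, ∀ T ∈ 𝒮, (U \ S).card = (U \ T).card)
    (hU : ∀ S ∈ 𝒮, ∀ T ∈ 𝒮, S \ U = T \ U) :
    (avoidingComplex U 𝒮).IsRecursivelyShellable := by
  induction h generalizing U with
  | subsingleton 𝒮 h =>
    obtain ⟨S, hS⟩ := hne
    have : avoidingComplex U 𝒮 = LowerSet.Iic (U \ S) := by
      ext σ
      change (σ ⊆ U ∧ ∃ S ∈ 𝒮, Disjoint σ S) ↔ σ ⊆ U \ S
      rw [subset_sdiff]
      constructor
      · rintro ⟨h1, T, hT, hd⟩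
        exact ⟨h1, h S hS T hT ▸ hd⟩
      · rintro ⟨h1, hd⟩
        exact ⟨h1, S, hS, hd⟩
    rw [this]
    exact .simplex _
  | split 𝒮 v hex _ _ ih₁ ih₂ =>
    by_cases h1 : ∃ S ∈ 𝒮, v ∈ S
    swap
    · have : 𝒮 = {S ∈ 𝒮 | v ∉ S} := by
        ext S; simp only [mem_filter]; grind
      rw [this] at hne hc hU ⊢
      exact ih₂ U hne hc hU
    by_cases h2 : ∃ S ∈ 𝒮, v ∉ S
    swap
    · have : 𝒮 = {S ∈ 𝒮 | v ∈ S} := by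
        ext S; simp only [mem_filter]; grind
      rw [this] at hne hc hU ⊢
      exact ih₁ U hne hc hU
    obtain ⟨S₁, hS₁, hv₁⟩ := h1
    obtain ⟨S₂, hS₂, hv₂⟩ := h2
    have hvU : v ∈ U := by
      by_contra hvU
      have := hU S₁ hS₁ S₂ hS₂
      have h3 : v ∈ S₁ \ U := mem_sdiff.2 ⟨hv₁, hvU⟩
      rw [this] at h3
      exact hv₂ (mem_sdiff.1 h3).1
    have hUe : ∀ S ∈ 𝒮, ∀ T ∈ 𝒮, (v ∈ S ↔ v ∈ T) → S \ U.erase v = T \ U.erase v := by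
      intro S hS T hT hv
      have := hU S hS T hT
      ext x
      have hx := Finset.ext_iff.1 this x
      simp only [mem_sdiff, mem_erase] at hx ⊢
      by_cases hxv : x = v
      · subst hxv; simpa using hv
      · simpa [hxv] using hx
    have hmem : ∀ S, v ∈ S → U.erase v \ S = U \ S := by
      intro S hv; ext x; simp only [mem_sdiff, mem_erase]; grind
    have hnot : ∀ S, v ∉ S → (U.erase v \ S).card = (U \ S).card - 1 := by
      intro S hv
      rw [erase_sdiff_comm, card_erase_of_mem (mem_sdiff.2 ⟨hvU, hv⟩)]
    have hc₁ : ∀ S ∈ ({S ∈ 𝒮 | v ∈ S} : Finset _), ∀ T ∈ ({S ∈ 𝒮 | v ∈ S} : Finset _),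
        (U.erase v \ S).card = (U.erase v \ T).card := by
      intro S hS T hT
      rw [mem_filter] at hS hT
      rw [hmem S hS.2, hmem T hT.2]
      exact hc S hS.1 T hT.1
    have hlink : (avoidingComplex U 𝒮).link v = avoidingComplex (U.erase v) {S ∈ 𝒮 | v ∉ S} := by
      ext σ
      change ((σ ⊆ U ∧ ∃ S ∈ 𝒮, Disjoint σ S) ∧ v ∉ σ ∧ insert v σ ⊆ U ∧
        ∃ S ∈ 𝒮, Disjoint (insert v σ) S) ↔
          σ ⊆ U.erase v ∧ ∃ S ∈ ({S ∈ 𝒮 | v ∉ S} : Finset _), Disjoint σ S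
      simp only [mem_filter, disjoint_insert_left, subset_erase, insert_subset_iff]
      constructor
      · rintro ⟨-, hvσ, ⟨-, hσ⟩, S, hS, hvS, hd⟩
        exact ⟨⟨hσ, hvσ⟩, S, ⟨hS, hvS⟩, hd⟩
      · rintro ⟨⟨hσ, hvσ⟩, S, ⟨hS, hvS⟩, hd⟩
        exact ⟨⟨hσ, S, hS, hd⟩, hvσ, ⟨hvU, hσ⟩, S, hS, hvS, hd⟩
    have hdel : (avoidingComplex U 𝒮).deletion v =
        avoidingComplex (U.erase v) {S ∈ 𝒮 | v ∈ S} := by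
      ext σ
      change ((σ ⊆ U ∧ ∃ S ∈ 𝒮, Disjoint σ S) ∧ v ∉ σ) ↔
        σ ⊆ U.erase v ∧ ∃ S ∈ ({S ∈ 𝒮 | v ∈ S} : Finset _), Disjoint σ S
      simp only [mem_filter, subset_erase]
      constructor
      · rintro ⟨⟨hσ, S, hS, hd⟩, hvσ⟩
        refine ⟨⟨hσ, hvσ⟩, ?_⟩
        by_cases hvS : v ∈ S
        · exact ⟨S, ⟨hS, hvS⟩, hd⟩
        · obtain ⟨T, hT, hvT, hTS⟩ := hex S hS hvS ⟨S₁, hS₁, hv₁⟩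
          exact ⟨T, ⟨hT, hvT⟩, (disjoint_insert_right.2 ⟨hvσ, hd⟩).mono_right hTS⟩
      · rintro ⟨⟨hσ, hvσ⟩, S, ⟨hS, hvS⟩, hd⟩
        exact ⟨⟨hσ, S, hS, hd⟩, hvσ⟩
    refine .shed _ v (avoidingComplex_isPure hc) ⟨?_, ?_⟩ ?_ ?_
    · exact mem_avoidingComplex.2 ⟨singleton_subset_iff.2 hvU, S₂, hS₂, disjoint_singleton_left.2 hv₂⟩
    · intro σ hσ
      rw [hdel, isFacet_avoidingComplex hc₁] at hσ
      obtain ⟨S, hS, rfl⟩ := hσ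
      rw [mem_filter] at hS
      exact (isFacet_avoidingComplex hc _).2 ⟨S, hS.1, (hmem S hS.2).symm⟩
    · rw [hlink]
      refine ih₂ _ ⟨S₂, mem_filter.2 ⟨hS₂, hv₂⟩⟩ ?_ ?_
      · intro S hS T hT
        rw [mem_filter] at hS hT
        rw [hnot S hS.2, hnot T hT.2, hc S hS.1 T hT.1]
      · intro S hS T hT
        rw [mem_filter] at hS hT
        exact hUe S hS.1 T hT.1 (iff_of_false hS.2 hT.2)
    · rw [hdel]
      refine ih₁ _ ⟨S₁, mem_filter.2 ⟨hS₁, hv₁⟩⟩ hc₁ ?_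
      intro S hS T hT
      rw [mem_filter] at hS hT
      exact hUe S hS.1 T hT.1 (iff_of_true hS.2 hT.2)

/-- The shelling order, encoded by a ranking of the family: at each split, the members containing
the splitting element precede those avoiding it. -/
theorem ExchangeDecomposable.exists_rank {𝒮 : Finset (Finset V)} (h : ExchangeDecomposable 𝒮) :
    ∃ r : Finset V → ℕ, Set.InjOn r 𝒮 ∧ ∀ S ∈ 𝒮, ∀ A ∈ 𝒮, r A < r S →
      ∃ B ∈ 𝒮, r B < r S ∧ ∃ x ∈ A, x ∉ S ∧ B ⊆ insert x S := by
  induction h with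
  | subsingleton 𝒮 h =>
    refine ⟨fun _ => 0, fun S hS T hT _ => h S hS T hT, ?_⟩
    intro S _ A _ hlt
    exact absurd hlt (lt_irrefl _)
  | split 𝒮 v hex _ _ ih₁ ih₂ =>
    obtain ⟨r₁, hi₁, h₁⟩ := ih₁
    obtain ⟨r₂, hi₂, h₂⟩ := ih₂
    have hN : ∀ S ∈ 𝒮, r₁ S < 𝒮.sup r₁ + 1 := fun S hS => Nat.lt_succ_of_le (le_sup (f := r₁) hS)
    generalize 𝒮.sup r₁ + 1 = N at hN
    refine ⟨fun S => if v ∈ S then r₁ S else N + r₂ S, ?_, ?_⟩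
    · intro S hS T hT hST
      have hS' : S ∈ 𝒮 := hS
      have hT' : T ∈ 𝒮 := hT
      have hNS := hN S hS
      have hNT := hN T hT
      dsimp only at hST
      split_ifs at hST with hvS hvT hvT
      · exact hi₁ (by simp [hS', hvS]) (by simp [hT', hvT]) hST
      · omega
      · omega
      · exact hi₂ (by simp [hS', hvS]) (by simp [hT', hvT]) (by omega)
    · intro S hS A hA hlt
      have hNS := hN S hS
      dsimp only at hlt ⊢
      by_cases hvS : v ∈ S
      · rw [if_pos hvS] at hlt
        have hvA : v ∈ A := by
          by_contra hvA
          rw [if_neg hvA] at hlt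
          omega
        rw [if_pos hvA] at hlt
        obtain ⟨B, hB, hBS, hx⟩ := h₁ S (mem_filter.2 ⟨hS, hvS⟩) A (mem_filter.2 ⟨hA, hvA⟩) hlt
        rw [mem_filter] at hB
        exact ⟨B, hB.1, by rwa [if_pos hB.2, if_pos hvS], hx⟩
      by_cases hvA : v ∈ A
      · obtain ⟨B, hB, hvB, hBS⟩ := hex S hS hvS ⟨A, hA, hvA⟩
        have := hN B hB
        exact ⟨B, hB, by rw [if_pos hvB, if_neg hvS]; omega, v, hvA, hvS, hBS⟩
      · rw [if_neg hvS, if_neg hvA] at hlt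
        obtain ⟨B, hB, hBS, hx⟩ :=
          h₂ S (mem_filter.2 ⟨hS, hvS⟩) A (mem_filter.2 ⟨hA, hvA⟩) (by omega)
        rw [mem_filter] at hB
        exact ⟨B, hB.1, by rw [if_neg hB.2, if_neg hvS]; omega, hx⟩

theorem ExchangeDecomposable.isShellable {𝒮 : Finset (Finset V)} (h : ExchangeDecomposable 𝒮)
    (U : Finset V) (hc : ∀ S ∈ 𝒮, ∀ T ∈ 𝒮, (U \ S).card = (U \ T).card)
    (hU : ∀ S ∈ 𝒮, S ⊆ U) : (avoidingComplex U 𝒮).IsShellable := by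
  obtain ⟨r, hr, hsh⟩ := h.exists_rank
  let e := (𝒮.image r).orderIsoOfFin rfl
  have he : ∀ i, ∃ S ∈ 𝒮, r S = e i := fun i => mem_image.1 (e i).2
  choose S hS hrS using he
  have hlt : ∀ i j, i < j ↔ r (S i) < r (S j) := by
    intro i j
    rw [hrS, hrS, Subtype.coe_lt_coe, e.lt_iff_lt]
  have hsurj : ∀ T ∈ 𝒮, ∃ i, S i = T := by
    intro T hT
    refine ⟨e.symm ⟨r T, mem_image_of_mem r hT⟩, hr (hS _) hT ?_⟩
    rw [hrS, e.apply_symm_apply]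
  have hinj : Function.Injective S := by
    intro i j hij
    rcases lt_trichotomy i j with h | h | h
    · exact absurd ((hlt i j).1 h) (by rw [hij]; exact lt_irrefl _)
    · exact h
    · exact absurd ((hlt j i).1 h) (by rw [hij]; exact lt_irrefl _)
  refine ⟨_, fun i => U \ S i, ?_, ?_, ?_⟩
  · intro i j hij
    apply hinj
    dsimp only at hij
    rw [← inter_eq_right.2 (hU _ (hS i)), ← inter_eq_right.2 (hU _ (hS j)), ← sdiff_sdiff_self_left,
      ← sdiff_sdiff_self_left U (S j), hij]
  · intro σ
    rw [isFacet_avoidingComplex hc]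
    constructor
    · rintro ⟨T, hT, rfl⟩
      obtain ⟨i, rfl⟩ := hsurj T hT
      exact ⟨i, rfl⟩
    · rintro ⟨i, rfl⟩
      exact ⟨S i, hS i, rfl⟩
  · intro j hj
    set K : Complex V := (⨆ s : {s // s < j}, LowerSet.Iic (U \ S s)) ⊓ LowerSet.Iic (U \ S j) with hK
    have hmem : ∀ σ, σ ∈ K ↔ (∃ s, s < j ∧ σ ⊆ U \ S s) ∧ σ ⊆ U \ S j := by
      intro σ
      simp [hK, LowerSet.mem_iSup_iff]
    -- Every face lies in a face of the expected dimension.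
    have key : ∀ σ ∈ K, ∃ x ∈ U \ S j, σ ⊆ (U \ S j).erase x ∧ (U \ S j).erase x ∈ K := by
      intro σ hσ
      obtain ⟨⟨i, hij, hi⟩, hσj⟩ := (hmem σ).1 hσ
      obtain ⟨B, hB, hlB, x, hxi, hxj, hBx⟩ := hsh _ (hS j) _ (hS i) ((hlt i j).1 hij)
      obtain ⟨l, rfl⟩ := hsurj B hB
      refine ⟨x, mem_sdiff.2 ⟨hU _ (hS i) hxi, hxj⟩, ?_, (hmem _).2 ⟨⟨l, (hlt l j).2 hlB, ?_⟩,
        erase_subset _ _⟩⟩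
      · refine subset_erase.2 ⟨hσj, fun hx => ?_⟩
        exact (mem_sdiff.1 (hi hx)).2 hxi
      · intro y hy
        have := @hBx y
        simp only [mem_erase, mem_sdiff, mem_insert] at hy this ⊢
        exact ⟨hy.2.1, fun h => (this h).elim hy.1 hy.2.2⟩
    have hcard : ∀ x ∈ U \ S j, (((U \ S j).erase x).card : ℤ) = ((U \ S j).card : ℤ) - 1 := by
      intro x hx
      have := card_erase_add_one hx
      omega
    refine ⟨?_, ?_, ?_⟩
    · have : ∀ σ, K.IsFacet σ → (σ.card : ℤ) = ((U \ S j).card : ℤ) - 1 := by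
        intro σ hσ
        obtain ⟨x, hx, hσx, hxK⟩ := key σ hσ.1
        rw [← hcard x hx, (hσx.antisymm (hσ.2 hxK hσx) : σ = _)]
      intro σ τ hσ hτ
      have h1 := this σ hσ
      have h2 := this τ hτ
      omega
    · have h0 : (∅ : Finset V) ∈ K :=
        (hmem _).2 ⟨⟨⟨0, hj.trans j.2⟩, hj, empty_subset _⟩, empty_subset _⟩
      obtain ⟨x, hx, -, hxK⟩ := key ∅ h0
      exact ⟨_, hxK, by rw [hcard x hx]⟩
    · rintro _ ⟨σ, hσ, rfl⟩
      obtain ⟨x, hx, hσx, -⟩ := key σ hσ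
      have := hcard x hx
      have := card_le_card hσx
      dsimp only
      omega

end Decomposable

/-! ### Disconnected vertex sets -/

/-- The graph induced on `S` is disconnected: the vertices of `S` can be coloured by `p` and its
negation, both colours occurring, such that no edge inside `S` joins the two colours. -/
def Separated {V : Type*} (G : SimpleGraph V) (S : Finset V) : Prop :=
  ∃ p : V → Prop, (∃ x ∈ S, p x) ∧ (∃ y ∈ S, ¬ p y) ∧ ∀ x ∈ S, ∀ y ∈ S, p x → ¬ p y → ¬ G.Adj x y

theorem not_preconnected_iff_separated {V : Type*} (G : SimpleGraph V) (S : Finset V) :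
    ¬ (G.induce (S : Set V)).Preconnected ↔ Separated G S := by
  constructor
  · intro h
    simp only [SimpleGraph.Preconnected, not_forall] at h
    obtain ⟨u, v, huv⟩ := h
    refine ⟨fun x => ∃ hx : x ∈ S, (G.induce (S : Set V)).Reachable u ⟨x, hx⟩,
      ⟨u, u.2, u.2, .rfl⟩, ⟨v, v.2, fun ⟨_, h⟩ => huv h⟩, ?_⟩
    rintro x hx y hy ⟨_, hux⟩ huy hxy
    refine huy ⟨hy, hux.trans (SimpleGraph.Adj.reachable ?_)⟩
    exact hxy
  · rintro ⟨p, ⟨x, hx, hpx⟩, ⟨y, hy, hpy⟩, hp⟩ h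
    have key : ∀ z, (G.induce (S : Set V)).Reachable ⟨x, hx⟩ z → p z := by
      intro z hz
      rw [SimpleGraph.reachable_iff_reflTransGen] at hz
      induction hz with
      | refl => exact hpx
      | @tail a b _ hab ih =>
        by_contra hpb
        exact hp a a.2 b b.2 ih hpb hab
    exact hpy (key ⟨y, hy⟩ (h _ _))

section Separated

variable {V : Type*} {G : SimpleGraph V}

/-- A colouring without bicoloured edges is constant on a connected subset; up to exchanging the
colours, it is `p` there. -/
theorem Separated.exists_of_subset {I S : Finset V} (h : Separated G S) (hIS : I ⊆ S)
    (hI : ¬ Separated G I) : ∃ p : V → Prop, (∀ x ∈ I, p x) ∧ (∃ x ∈ S, p x) ∧ (∃ y ∈ S, ¬ p y) ∧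
      ∀ x ∈ S, ∀ y ∈ S, p x → ¬ p y → ¬ G.Adj x y := by
  obtain ⟨p, hx, hy, hp⟩ := h
  by_cases h1 : ∀ x ∈ I, p x
  · exact ⟨p, h1, hx, hy, hp⟩
  push Not at h1
  obtain ⟨y, hyI, hpy⟩ := h1
  refine ⟨fun x => ¬ p x, ?_, hy, by simpa using hx, ?_⟩
  · intro x hxI hpx
    exact hI ⟨p, ⟨x, hxI, hpx⟩, ⟨y, hyI, hpy⟩, fun a ha b hb => hp a (hIS ha) b (hIS hb)⟩
  · intro a ha b hb hpa hpb hab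
    exact hp b hb a ha (not_not.1 hpb) hpa hab.symm

variable [DecidableEq V]

theorem not_separated_insert {I : Finset V} (hI : ¬ Separated G I) {u v : V} (hu : u ∈ I)
    (huv : G.Adj u v) : ¬ Separated G (insert v I) := by
  intro h
  obtain ⟨p, hpI, -, ⟨y, hy, hpy⟩, hp⟩ := h.exists_of_subset (subset_insert v I) hI
  rcases mem_insert.1 hy with rfl | hy
  · exact hp u (mem_insert_of_mem hu) y (mem_insert_self _ _) (hpI u hu) hpy huv
  · exact hpy (hpI y hy)

/-- If a new vertex `v` has neighbours of at most one of the two colours of `S`, it can be given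
that colour, and then any vertex `w` may be left out that is not the last one of the other
colour. -/
theorem exists_separated_insert_erase {I S : Finset V} {p : V → Prop} {v : V} (hv : v ∉ S)
    (hcard : I.card + 2 ≤ S.card) (hy : ∃ y ∈ S, ¬ p y)
    (hp : ∀ x ∈ S, ∀ y ∈ S, p x → ¬ p y → ¬ G.Adj x y) (hvp : ∀ x ∈ S, ¬ p x → ¬ G.Adj v x) :
    ∃ w ∈ S, w ∉ I ∧ Separated G (insert v (S.erase w)) := by
  obtain ⟨y, hy, hpy⟩ := hy
  obtain ⟨w, hwS, hw⟩ := exists_mem_notMem_of_card_lt_card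
    (by have := card_insert_le y I; omega : (insert y I).card < S.card)
  rw [mem_insert, not_or] at hw
  refine ⟨w, hwS, hw.2, fun x => x = v ∨ p x, ⟨v, mem_insert_self _ _, .inl rfl⟩,
    ⟨y, by simp [hy, Ne.symm hw.1], ?_⟩, ?_⟩
  · rintro (rfl | h)
    exacts [hv hy, hpy h]
  · intro a ha b hb hpa hpb hab
    simp only [mem_insert, mem_erase, not_or] at ha hb hpb
    have hbS : b ∈ S := (hb.resolve_left hpb.1).2
    rcases hpa with rfl | hpa
    · exact hvp b hbS hpb.2 hab
    · rcases ha with rfl | ha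
      · exact hvp b hbS hpb.2 hab
      · exact hp a ha.2 b hbS hpa hpb.2 hab

end Separated

/-! ### Intervals of `k`-element sets -/

section Interval

variable {V : Type*} [DecidableEq V]

open Classical in
/-- The `k`-element sets `S` with `D ⊆ S ⊆ U` that have the property `Q`. -/
noncomputable def intervalFamily (Q : Finset V → Prop) (k : ℕ) (D U : Finset V) :
    Finset (Finset V) :=
  {S ∈ U.powersetCard k | D ⊆ S ∧ Q S}

variable {Q : Finset V → Prop} {k : ℕ} {D U : Finset V}

theorem mem_intervalFamily {S : Finset V} :
    S ∈ intervalFamily Q k D U ↔ (S ⊆ U ∧ S.card = k) ∧ D ⊆ S ∧ Q S := by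
  simp [intervalFamily, mem_powersetCard]

theorem ExchangeDecomposable.intervalFamily_split {v : V} (hv : v ∈ U)
    (hex : ∀ S, D ⊆ S → S ⊆ U → S.card = k → Q S → v ∉ S →
      ∃ w ∈ S, w ∉ D ∧ Q (insert v (S.erase w)))
    (hmem : ExchangeDecomposable (intervalFamily Q k (insert v D) U))
    (hnot : ExchangeDecomposable (intervalFamily Q k D (U.erase v))) :
    ExchangeDecomposable (intervalFamily Q k D U) := by
  refine .split _ v ?_ ?_ ?_
  · intro S hS hvS _
    obtain ⟨⟨hSU, hc⟩, hDS, hQ⟩ := mem_intervalFamily.1 hS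
    obtain ⟨w, hwS, hwD, hQ'⟩ := hex S hDS hSU hc hQ hvS
    refine ⟨_, mem_intervalFamily.2 ⟨⟨insert_subset hv ((erase_subset _ _).trans hSU), ?_⟩, ?_, hQ'⟩,
      mem_insert_self _ _, insert_subset_insert _ (erase_subset _ _)⟩
    · rw [card_insert_of_notMem (fun h => hvS (mem_of_mem_erase h)), card_erase_add_one hwS, hc]
    · exact (subset_erase.2 ⟨hDS, hwD⟩).trans (subset_insert _ _)
  · convert hmem using 1
    ext S
    simp only [mem_filter, mem_intervalFamily, insert_subset_iff]
    tauto
  · convert hnot using 1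
    ext S
    simp only [mem_filter, mem_intervalFamily, subset_erase]
    tauto

theorem exchangeDecomposable_of_card_le (h : k ≤ D.card) :
    ExchangeDecomposable (intervalFamily Q k D U) := by
  have : ∀ S ∈ intervalFamily Q k D U, D = S := by
    intro S hS
    obtain ⟨⟨hSU, hc⟩, hDS, hQ⟩ := mem_intervalFamily.1 hS
    exact eq_of_subset_of_card_le hDS (hc.le.trans h)
  exact .subsingleton _ fun S hS T hT => (this S hS).symm.trans (this T hT)

theorem exchangeDecomposable_of_card_lt (h : U.card < k) :
    ExchangeDecomposable (intervalFamily Q k D U) := by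
  refine .subsingleton _ fun S hS => ?_
  obtain ⟨⟨hSU, hc⟩, -⟩ := mem_intervalFamily.1 hS
  exact absurd (card_le_card hSU) (by omega)

theorem exchangeDecomposable_of_subset (h : U ⊆ D) :
    ExchangeDecomposable (intervalFamily Q k D U) := by
  by_cases hk : k ≤ D.card
  · exact exchangeDecomposable_of_card_le hk
  · exact exchangeDecomposable_of_card_lt ((card_le_card h).trans_lt (not_le.1 hk))

theorem exchangeDecomposable_of_card_le_succ (h : k ≤ D.card + 1) :
    ExchangeDecomposable (intervalFamily Q k D U) := by
  induction hn : (U \ D).card generalizing U with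
  | zero => exact exchangeDecomposable_of_subset (sdiff_eq_empty_iff_subset.1 (card_eq_zero.1 hn))
  | succ n ih =>
    obtain ⟨v, hv⟩ := card_pos.1 (by omega : 0 < (U \ D).card)
    have hv' := mem_sdiff.1 hv
    have hins : (insert v D).card = D.card + 1 := card_insert_of_notMem hv'.2
    refine .split _ v ?_ ?_ ?_
    · rintro S hS - ⟨T, hT, hvT⟩
      obtain ⟨⟨-, hc⟩, hDT, -⟩ := mem_intervalFamily.1 hT
      obtain ⟨-, hDS, -⟩ := mem_intervalFamily.1 hS
      refine ⟨T, hT, hvT, ?_⟩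
      rw [← eq_of_subset_of_card_le (insert_subset hvT hDT) (by omega)]
      exact insert_subset_insert _ hDS
    · convert exchangeDecomposable_of_card_le (Q := Q) (U := U) (h.trans hins.ge) using 1
      ext S
      simp only [mem_filter, mem_intervalFamily, insert_subset_iff]
      tauto
    · have hn' : (U.erase v \ D).card = n := by
        rw [erase_sdiff_comm, card_erase_of_mem hv, hn]; rfl
      convert ih hn' using 1
      ext S
      simp only [mem_filter, mem_intervalFamily, subset_erase]
      tauto

/-- When all sets in the interval that avoid the pivot `c` have the property `Q`, splitting at the
other elements before `c` works: a member containing `c` may give up `c` in exchange for any new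
element. -/
theorem exchangeDecomposable_of_pivot {c : V} (hcD : c ∉ D)
    (hc : ∀ S, D ⊆ S → S ⊆ U → S.card = k → c ∉ S → Q S) :
    ExchangeDecomposable (intervalFamily Q k D U) := by
  induction hn : (U \ D).card generalizing U D with
  | zero => exact exchangeDecomposable_of_subset (sdiff_eq_empty_iff_subset.1 (card_eq_zero.1 hn))
  | succ n ih =>
    by_cases hk : k ≤ D.card + 1
    · exact exchangeDecomposable_of_card_le_succ hk
    by_cases hv : ∃ v ∈ U \ D, v ≠ c
    swap
    · push Not at hv
      have h1 : U ⊆ insert c D := by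
        intro x hx
        by_cases hxD : x ∈ D
        · exact mem_insert_of_mem hxD
        · rw [hv x (mem_sdiff.2 ⟨hx, hxD⟩)]
          exact mem_insert_self _ _
      have h2 := (card_le_card h1).trans (card_insert_le c D)
      exact exchangeDecomposable_of_card_lt (by omega)
    obtain ⟨v, hv, hvc⟩ := hv
    have hv' := mem_sdiff.1 hv
    refine .intervalFamily_split hv'.1 ?_ ?_ ?_
    · intro S hDS hSU hSk hQ hvS
      have hw : ∃ w ∈ S, w ∉ D ∧ c ∉ S.erase w := by
        by_cases hcS : c ∈ S
        · exact ⟨c, hcS, hcD, notMem_erase _ _⟩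
        · obtain ⟨w, hwS, hwD⟩ := exists_mem_notMem_of_card_lt_card (by omega : D.card < S.card)
          exact ⟨w, hwS, hwD, fun h => hcS (mem_of_mem_erase h)⟩
      obtain ⟨w, hwS, hwD, hcw⟩ := hw
      refine ⟨w, hwS, hwD, hc _ ?_ ?_ ?_ ?_⟩
      · exact (subset_erase.2 ⟨hDS, hwD⟩).trans (subset_insert _ _)
      · exact insert_subset hv'.1 ((erase_subset _ _).trans hSU)
      · rw [card_insert_of_notMem (fun h => hvS (mem_of_mem_erase h)), card_erase_add_one hwS, hSk]
      · rw [mem_insert, not_or]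
        exact ⟨hvc.symm, hcw⟩
    · refine ih (by simp [hvc.symm, hcD]) (fun S hDS => hc S ((subset_insert _ _).trans hDS)) ?_
      rw [sdiff_insert, card_erase_of_mem hv, hn]; rfl
    · refine ih hcD (fun S hDS hSU => hc S hDS (hSU.trans (erase_subset _ _))) ?_
      rw [erase_sdiff_comm, card_erase_of_mem hv, hn]; rfl

end Interval

/-! ### The grid with two rows -/

section Grid

variable {n : ℕ}

theorem grid_adj {x y : Fin 2 × Fin n} : (grid n).Adj x y ↔
    (x.1 = y.1 ∧ ((x.2 : ℕ) + 1 = y.2 ∨ (y.2 : ℕ) + 1 = x.2)) ∨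
      (x.1 ≠ y.1 ∧ (x.2 : ℕ) = y.2) := by
  simp only [grid, SimpleGraph.boxProd_adj, SimpleGraph.pathGraph_adj, Fin.ext_iff, ne_eq]
  have := x.1.2
  have := y.1.2
  omega

theorem vertex_eq {x y : Fin 2 × Fin n} (h1 : x.1 = y.1) (h2 : (x.2 : ℕ) = y.2) : x = y :=
  Prod.ext h1 (Fin.ext h2)

theorem le_column_iff {m : ℕ} (hm : m < n) {x : Fin 2 × Fin n} :
    m ≤ (x.2 : ℕ) ↔ x = (0, ⟨m, hm⟩) ∨ x = (1, ⟨m, hm⟩) ∨ m + 1 ≤ (x.2 : ℕ) := by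
  simp only [Prod.ext_iff, Fin.ext_iff, Fin.val_zero, Fin.val_one]
  have := x.1.2
  omega

/-- A vertex set is disconnected when it contains no edge between the columns before `m` and
those from `m` on, and vertices on both sides. -/
theorem separated_of_column {S : Finset (Fin 2 × Fin n)} (m : ℕ) (hx : ∃ x ∈ S, (x.2 : ℕ) < m)
    (hy : ∃ y ∈ S, m ≤ (y.2 : ℕ))
    (h : ∀ x ∈ S, ∀ y ∈ S, x.1 = y.1 → (x.2 : ℕ) + 1 = m → (y.2 : ℕ) = m → False) :
    Separated (grid n) S := by
  refine ⟨fun x => (x.2 : ℕ) < m, hx, by simpa using hy, ?_⟩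
  intro x hxS y hyS hxm hym hxy
  rw [grid_adj] at hxy
  rcases hxy with ⟨h1, h2⟩ | ⟨-, h2⟩
  · exact h x hxS y hyS h1 (by omega) (by omega)
  · omega

variable {k m : ℕ} {I U : Finset (Fin 2 × Fin n)}

/-- If the chosen part `I`, which lies in the columns before `m`, is joined to the undecided
vertices only through row `i` of column `m`, then that vertex is a pivot. -/
theorem exchangeDecomposable_of_single_row {i : Fin 2} (hne : I.Nonempty)
    (hI : ∀ x ∈ I, (x.2 : ℕ) < m) (hU : ∀ x ∈ U, x ∉ I → m ≤ (x.2 : ℕ))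
    (hrow : ∀ x ∈ I, ∀ y ∈ U, x.1 = y.1 → (x.2 : ℕ) + 1 = m → (y.2 : ℕ) = m → y.1 = i) :
    ExchangeDecomposable (intervalFamily (Separated (grid n)) k I U) := by
  by_cases hm : m < n
  swap
  · refine exchangeDecomposable_of_subset fun x hx => ?_
    by_contra hxI
    have := hU x hx hxI
    have := x.2.2
    omega
  by_cases hk : k ≤ I.card
  · exact exchangeDecomposable_of_card_le hk
  refine exchangeDecomposable_of_pivot (c := (i, ⟨m, hm⟩)) (fun h => (hI _ h).ne rfl) ?_
  intro S hIS hSU hSk hc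
  obtain ⟨x, hx⟩ := hne
  obtain ⟨y, hyS, hyI⟩ := exists_mem_notMem_of_card_lt_card (by omega : I.card < S.card)
  refine separated_of_column m ⟨x, hIS hx, hI x hx⟩ ⟨y, hyS, hU y (hSU hyS) hyI⟩ ?_
  intro a ha b hb hab ham hbm
  have haI : a ∈ I := by
    by_contra haI
    have := hU a (hSU ha) haI
    omega
  have : b = (i, ⟨m, hm⟩) := vertex_eq (hrow a haI b (hSU hb) hab ham hbm) hbm
  exact hc (this ▸ hb)

/-- The vertex in row `1` of column `m` is split off next, when the chosen part `I` is connected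
and contains the vertex in row `0` of that column. -/
theorem exchangeDecomposable_of_first_row (hm : m < n) (ha : ((0, ⟨m, hm⟩) : Fin 2 × Fin n) ∈ I)
    (hb : ((1, ⟨m, hm⟩) : Fin 2 × Fin n) ∉ I) (hI : ∀ x ∈ I, (x.2 : ℕ) ≤ m)
    (hconn : ¬ Separated (grid n) I)
    (hU : ∀ x, x ∈ U ↔ x ∈ I ∨ x = (1, ⟨m, hm⟩) ∨ m + 1 ≤ (x.2 : ℕ)) (hk : I.card + 2 ≤ k)
    (hmem : ExchangeDecomposable
      (intervalFamily (Separated (grid n)) k (insert (1, ⟨m, hm⟩) I) U)) :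
    ExchangeDecomposable (intervalFamily (Separated (grid n)) k I U) := by
  set a : Fin 2 × Fin n := (0, ⟨m, hm⟩)
  set b : Fin 2 × Fin n := (1, ⟨m, hm⟩)
  have ha1 : a.1 = 0 := rfl
  have ha2 : (a.2 : ℕ) = m := rfl
  have hb1 : b.1 = 1 := rfl
  have hb2 : (b.2 : ℕ) = m := rfl
  refine .intervalFamily_split ((hU b).2 (.inr (.inl rfl))) ?_ hmem ?_
  · intro S hIS hSU hSk hS hbS
    obtain ⟨p, hpI, -, hy, hp⟩ := hS.exists_of_subset hIS hconn
    by_cases hvp : ∀ x ∈ S, ¬ p x → ¬ (grid n).Adj b x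
    · exact exists_separated_insert_erase hbS (by omega) hy hp hvp
    -- The neighbour of `b` to its right has the other colour; it is exchanged for `b`. Column
    -- `m + 1` is then empty, since the vertex above it would have neighbours of both colours.
    push Not at hvp
    obtain ⟨c, hcS, hpc, hbc⟩ := hvp
    have hcI : c ∉ I := fun h => hpc (hpI c h)
    have hcm : m + 1 ≤ (c.2 : ℕ) := by
      rcases (hU c).1 (hSU hcS) with h | rfl | h
      exacts [absurd h hcI, absurd hcS hbS, h]
    rw [grid_adj] at hbc
    have hc1 : c.1 = 1 := by
      rcases hbc with h | h
      exacts [h.1.symm.trans hb1, by omega]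
    have hc2 : (c.2 : ℕ) = m + 1 := by omega
    obtain ⟨y, hyS, hy⟩ := exists_mem_notMem_of_card_lt_card
      (by have := card_insert_le c I; omega : (insert c I).card < S.card)
    rw [mem_insert, not_or] at hy
    have hym : m + 1 ≤ (y.2 : ℕ) := by
      rcases (hU y).1 (hSU hyS) with h | rfl | h
      exacts [absurd h hy.2, absurd hyS hbS, h]
    refine ⟨c, hcS, hcI, separated_of_column (m + 1) ⟨b, mem_insert_self _ _, by omega⟩
      ⟨y, by simp [hy.1, hyS], hym⟩ ?_⟩
    intro s _ t ht _ _ htm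
    have htb : t ≠ b := fun h => by rw [h] at htm; omega
    simp only [mem_insert, mem_erase, htb, false_or] at ht
    have ht1 : t.1 ≠ 1 := fun h => ht.1 (vertex_eq (h.trans hc1.symm) (by omega))
    have hpt : p t := by
      by_contra hpt
      exact hp a (hIS ha) t ht.2 (hpI a ha) hpt (grid_adj.2 (.inl ⟨by omega, by omega⟩))
    exact hp t ht.2 c hcS hpt hpc (grid_adj.2 (.inr ⟨by omega, by omega⟩))
  · refine exchangeDecomposable_of_single_row (m := m + 1) (i := 0) ⟨a, ha⟩
      (fun x hx => Nat.lt_succ_of_le (hI x hx)) ?_ ?_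
    · intro x hx hxI
      rw [mem_erase, hU] at hx
      exact (hx.2.resolve_left hxI).resolve_left hx.1
    · intro x hxI y _ hxy hxm _
      have : x.1 ≠ 1 := fun h => hb (vertex_eq (x := x) (y := b) h (by omega) ▸ hxI)
      omega

theorem exists_pair {V : Type*} [DecidableEq V] {I S : Finset V} (hIS : I ⊆ S)
    (h : S.card = I.card + 2) (c : V) : ∃ w ∈ S, w ∉ I ∧ ∃ z ∈ S, z ∉ I ∧ z ≠ w ∧ z ≠ c ∧
      ∀ x ∈ S, x ∉ I → x = w ∨ x = z := by
  have hc : (S \ I).card = 2 := by rw [card_sdiff_of_subset hIS]; omega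
  obtain ⟨x, y, hxy, hST⟩ := card_eq_two.1 hc
  have hmem : ∀ z, z ∈ S ∧ z ∉ I ↔ z = x ∨ z = y := by
    intro z
    rw [← mem_sdiff, hST, mem_insert, mem_singleton]
  have hx := (hmem x).2 (.inl rfl)
  have hy := (hmem y).2 (.inr rfl)
  by_cases hyc : y = c
  · exact ⟨y, hy.1, hy.2, x, hx.1, hx.2, hxy, hyc ▸ hxy, fun z h1 h2 => ((hmem z).1 ⟨h1, h2⟩).symm⟩
  · exact ⟨x, hx.1, hx.2, y, hy.1, hy.2, hxy.symm, hyc, fun z h1 h2 => (hmem z).1 ⟨h1, h2⟩⟩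

/-- Only two vertices remain to be chosen: a vertex in column `m + 1` can replace either of them,
unless the one kept is its neighbour in column `m`; after that, so can the neighbour itself. -/
theorem exchangeDecomposable_of_card_eq_add_two (hm : m < n) (hne : I.Nonempty)
    (hI : ∀ x ∈ I, (x.2 : ℕ) < m) (hU : ∀ x, x ∈ U ↔ x ∈ I ∨ m ≤ (x.2 : ℕ))
    (hk : k = I.card + 2) :
    ExchangeDecomposable (intervalFamily (Separated (grid n)) k I U) := by
  set a : Fin 2 × Fin n := (0, ⟨m, hm⟩)
  set b : Fin 2 × Fin n := (1, ⟨m, hm⟩)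
  have ha1 : a.1 = 0 := rfl
  have ha2 : (a.2 : ℕ) = m := rfl
  have hb1 : b.1 = 1 := rfl
  have hb2 : (b.2 : ℕ) = m := rfl
  have hbI : b ∉ I := fun h => by have := hI b h; omega
  have hbU : b ∈ U := (hU b).2 (.inr hb2.ge)
  have hins : ∀ v ∉ I, k ≤ (insert v I).card + 1 := fun v hv => by
    rw [card_insert_of_notMem hv]; omega
  have hUm : ∀ x ∈ U, x ∉ I → m ≤ (x.2 : ℕ) := fun x hx hxI => ((hU x).1 hx).resolve_left hxI
  clear_value a b
  -- The case in which the vertex to the right of `b` is no longer available.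
  have main : ∀ W ⊆ U, b ∈ W → (∀ x ∈ W, x.1 = 1 → (x.2 : ℕ) ≠ m + 1) →
      ExchangeDecomposable (intervalFamily (Separated (grid n)) k I W) := by
    intro W hWU hbW hW
    refine .intervalFamily_split hbW ?_ (exchangeDecomposable_of_card_le_succ (hins b hbI)) ?_
    · intro S hIS hSW hSk _ hbS
      obtain ⟨w, hwS, hwI, z, hzS, hzI, hzw, hza, hS⟩ := exists_pair hIS (by omega) a
      have hzm : m + 1 ≤ (z.2 : ℕ) := by
        have h1 := hUm z (hWU (hSW hzS)) hzI
        by_contra h2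
        by_cases h3 : z.1 = 0
        · exact hza (vertex_eq (by omega) (by omega))
        · exact hbS (vertex_eq (x := z) (y := b) (by omega) (by omega) ▸ hzS)
      refine ⟨w, hwS, hwI, separated_of_column (m + 1) ⟨b, mem_insert_self _ _, by omega⟩
        ⟨z, by simp [hzw, hzS], hzm⟩ ?_⟩
      intro s hs t ht hst hsm htm
      have htb : t ≠ b := fun h => by rw [h] at htm; omega
      simp only [mem_insert, mem_erase, htb, false_or] at ht
      have ht1 : t.1 ≠ 1 := fun h => hW t (hSW ht.2) h htm
      have hsb : s ≠ b := fun h => by rw [h] at hst; omega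
      simp only [mem_insert, mem_erase, hsb, false_or] at hs
      by_cases hsI : s ∈ I
      · have := hI s hsI
        omega
      · rcases hS s hs.2 hsI with h | rfl
        exacts [hs.1 h, by omega]
    · refine exchangeDecomposable_of_single_row (m := m) (i := 0) hne hI
        (fun x hx => hUm x (hWU (mem_of_mem_erase hx))) ?_
      intro x _ y hy _ _ hym
      have : y.1 ≠ 1 := fun h => (mem_erase.1 hy).1 (vertex_eq (by omega) (by omega))
      omega
  by_cases hm' : m + 1 < n
  swap
  · refine main U subset_rfl hbU fun x _ _ h => ?_
    have := x.2.2
    omega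
  obtain ⟨c, hc1, hc2⟩ : ∃ c : Fin 2 × Fin n, c.1 = 1 ∧ (c.2 : ℕ) = m + 1 :=
    ⟨(1, ⟨m + 1, hm'⟩), rfl, rfl⟩
  have hcI : c ∉ I := fun h => by have := hI c h; omega
  refine .intervalFamily_split (v := c) ((hU c).2 (.inr (by omega))) ?_
    (exchangeDecomposable_of_card_le_succ (hins c hcI)) ?_
  · intro S hIS hSU hSk _ hcS
    obtain ⟨w, hwS, hwI, z, hzS, hzI, hzw, hzb, hS⟩ := exists_pair hIS (by omega) b
    have hzm := hUm z (hSU hzS) hzI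
    have hS' : ∀ x ∈ insert c (S.erase w), x = c ∨ x = z ∨ (x.2 : ℕ) < m := by
      intro x hx
      simp only [mem_insert, mem_erase] at hx
      rcases hx with hx | ⟨hxw, hxS⟩
      · exact .inl hx
      by_cases hxI : x ∈ I
      · exact .inr (.inr (hI x hxI))
      · exact .inr (.inl ((hS x hxS hxI).resolve_left hxw))
    refine ⟨w, hwS, hwI, ?_⟩
    by_cases hz : (z.2 : ℕ) = m
    · have hz1 : z.1 ≠ 1 := fun h => hzb (vertex_eq (by omega) (by omega))
      refine separated_of_column (m + 1) ⟨z, by simp [hzw, hzS], by omega⟩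
        ⟨c, mem_insert_self _ _, by omega⟩ ?_
      intro s hs t ht hst hsm htm
      rcases hS' s hs with rfl | rfl | h
      · omega
      · rcases hS' t ht with rfl | rfl | h' <;> omega
      · omega
    · obtain ⟨x, hx⟩ := hne
      refine separated_of_column m ⟨x, ?_, hI x hx⟩ ⟨c, mem_insert_self _ _, by omega⟩ ?_
      · exact mem_insert_of_mem (mem_erase.2 ⟨fun h => hwI (h ▸ hx), hIS hx⟩)
      · intro s _ t ht _ _ htm
        rcases hS' t ht with rfl | rfl | h' <;> omega
  · refine main _ (erase_subset _ _) (mem_erase.2 ⟨fun h => ?_, hbU⟩) fun x hx h1 h2 => ?_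
    · rw [h] at hb2
      omega
    · exact (mem_erase.1 hx).1 (vertex_eq (by omega) (by omega))

/-- The chosen part is connected and contains both vertices of column `m - 1`. -/
theorem exchangeDecomposable_of_both_rows (hI : ∀ x ∈ I, (x.2 : ℕ) < m)
    (hconn : ¬ Separated (grid n) I) (h₀ : ∃ x ∈ I, x.1 = 0 ∧ (x.2 : ℕ) + 1 = m)
    (h₁ : ∃ x ∈ I, x.1 = 1 ∧ (x.2 : ℕ) + 1 = m) (hU : ∀ x, x ∈ U ↔ x ∈ I ∨ m ≤ (x.2 : ℕ)) :
    ExchangeDecomposable (intervalFamily (Separated (grid n)) k I U) := by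
  induction hd : n - m generalizing m I with
  | zero =>
    refine exchangeDecomposable_of_subset fun x hx => ((hU x).1 hx).resolve_right ?_
    have := x.2.2
    omega
  | succ d ih =>
    have hm : m < n := by omega
    obtain ⟨u₀, hu₀, hu₀1, hu₀2⟩ := h₀
    obtain ⟨u₁, hu₁, hu₁1, hu₁2⟩ := h₁
    by_cases hk1 : k ≤ I.card + 1
    · exact exchangeDecomposable_of_card_le_succ hk1
    by_cases hk2 : k = I.card + 2
    · exact exchangeDecomposable_of_card_eq_add_two hm ⟨u₀, hu₀⟩ hI hU hk2
    have hk3 : I.card + 3 ≤ k := by omega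
    set a : Fin 2 × Fin n := (0, ⟨m, hm⟩)
    set b : Fin 2 × Fin n := (1, ⟨m, hm⟩)
    have ha1 : a.1 = 0 := rfl
    have ha2 : (a.2 : ℕ) = m := rfl
    have hb1 : b.1 = 1 := rfl
    have hb2 : (b.2 : ℕ) = m := rfl
    have hab : a ≠ b := by simp [a, b]
    have haI : a ∉ I := fun h => by have := hI a h; omega
    have hbI : b ∉ I := fun h => by have := hI b h; omega
    have hcolm := fun x => le_column_iff hm (x := x)
    have hconna : ¬ Separated (grid n) (insert a I) :=
      not_separated_insert hconn hu₀ (grid_adj.2 (.inl ⟨by omega, by omega⟩))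
    have hconnb : ¬ Separated (grid n) (insert b (insert a I)) :=
      not_separated_insert hconna (mem_insert_self _ _) (grid_adj.2 (.inr ⟨by omega, by omega⟩))
    refine .intervalFamily_split (v := a) ((hU a).2 (.inr ha2.ge)) ?_ ?_ ?_
    · intro S hIS hSU hSk hS haS
      obtain ⟨p, hpI, -, hy, hp⟩ := hS.exists_of_subset hIS hconn
      have hpb : b ∈ S → p b := by
        intro hb
        by_contra hpb
        exact hp u₁ (hIS hu₁) b hb (hpI _ hu₁) hpb (grid_adj.2 (.inl ⟨by omega, by omega⟩))
      by_cases hvp : ∀ x ∈ S, ¬ p x → ¬ (grid n).Adj a x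
      · exact exists_separated_insert_erase haS (by omega) hy hp hvp
      -- The neighbour of `a` to its right has the other colour; it is exchanged for `a`. Then no
      -- edge joins columns `m` and `m + 1`, and some vertex is left beyond column `m`, because at
      -- least three vertices were to be chosen.
      push Not at hvp
      obtain ⟨c, hcS, hpc, hac⟩ := hvp
      have hcI : c ∉ I := fun h => hpc (hpI c h)
      have hmid : ∀ x ∈ S, x ∉ I → x ≠ b → m + 1 ≤ (x.2 : ℕ) := by
        intro x hx hxI hxb
        rcases (hcolm x).1 (((hU x).1 (hSU hx)).resolve_left hxI) with rfl | h | h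
        exacts [absurd hx haS, absurd h hxb, h]
      have hcm := hmid c hcS hcI (fun h => hpc (h ▸ hpb (h ▸ hcS)))
      rw [grid_adj] at hac
      have hc1 : c.1 = 0 := by
        rcases hac with h | h
        exacts [h.1.symm.trans ha1, by omega]
      have hc2 : (c.2 : ℕ) = m + 1 := by omega
      obtain ⟨y, hyS, hy⟩ := exists_mem_notMem_of_card_lt_card
        (by
          have := card_insert_le c (insert b I)
          have := card_insert_le b I
          omega : (insert c (insert b I)).card < S.card)
      simp only [mem_insert, not_or] at hy
      refine ⟨c, hcS, hcI, separated_of_column (m + 1) ⟨a, mem_insert_self _ _, by omega⟩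
        ⟨y, by simp [hy.1, hyS], hmid y hyS hy.2.2 hy.2.1⟩ ?_⟩
      intro s hs t ht hst hsm htm
      have hta : t ≠ a := fun h => by rw [h] at htm; omega
      simp only [mem_insert, mem_erase, hta, false_or] at ht
      have ht1 : t.1 ≠ 0 := fun h => ht.1 (vertex_eq (h.trans hc1.symm) (by omega))
      have hsb : s = b := vertex_eq (by omega) (by omega)
      have hbS : b ∈ S := by
        rw [hsb, mem_insert] at hs
        exact mem_of_mem_erase (hs.resolve_left hab.symm)
      have hpt : p t := by
        by_contra hpt
        exact hp b hbS t ht.2 (hpb hbS) hpt (grid_adj.2 (.inl ⟨by omega, by omega⟩))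
      exact hp t ht.2 c hcS hpt hpc (grid_adj.2 (.inr ⟨by omega, by omega⟩))
    · refine exchangeDecomposable_of_first_row hm (mem_insert_self _ _) ?_ ?_ hconna ?_ ?_ ?_
      · rw [mem_insert, not_or]
        exact ⟨hab.symm, hbI⟩
      · intro x hx
        rcases mem_insert.1 hx with rfl | hx
        exacts [ha2.le, (hI x hx).le]
      · intro x
        rw [hU, hcolm, mem_insert]
        tauto
      · rw [card_insert_of_notMem haI]
        omega
      · refine ih (m := m + 1) (I := insert b (insert a I)) ?_ hconnb ⟨a, by simp, ha1, by omega⟩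
          ⟨b, by simp, hb1, by omega⟩ ?_ (by omega)
        · intro x hx
          simp only [mem_insert] at hx
          rcases hx with rfl | rfl | hx
          · omega
          · omega
          · have := hI x hx
            omega
        · intro x
          rw [hU, hcolm, mem_insert, mem_insert]
          tauto
    · refine exchangeDecomposable_of_single_row (m := m) (i := 1) ⟨u₀, hu₀⟩ hI ?_ ?_
      · intro x hx hxI
        exact ((hU x).1 (mem_of_mem_erase hx)).resolve_left hxI
      · intro x _ y hy _ _ hym
        have : y.1 ≠ 0 := fun h => (mem_erase.1 hy).1 (vertex_eq h (by omega))
        omega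

/-- Nothing has been chosen so far, and the columns before `m` have been removed. -/
theorem exchangeDecomposable_of_columns (hk : 3 ≤ k) (hU : ∀ x, x ∈ U ↔ m ≤ (x.2 : ℕ)) :
    ExchangeDecomposable (intervalFamily (Separated (grid n)) k ∅ U) := by
  induction hd : n - m generalizing m U with
  | zero =>
    refine exchangeDecomposable_of_subset fun x hx => ?_
    have := (hU x).1 hx
    have := x.2.2
    omega
  | succ d ih =>
    have hm : m < n := by omega
    set a : Fin 2 × Fin n := (0, ⟨m, hm⟩)
    set b : Fin 2 × Fin n := (1, ⟨m, hm⟩)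
    have ha1 : a.1 = 0 := rfl
    have ha2 : (a.2 : ℕ) = m := rfl
    have hb1 : b.1 = 1 := rfl
    have hb2 : (b.2 : ℕ) = m := rfl
    have hab : a ≠ b := by simp [a, b]
    have hcolm := fun x => le_column_iff hm (x := x)
    have hconna : ¬ Separated (grid n) (insert a ∅) := by
      rintro ⟨p, ⟨x, hx, hpx⟩, ⟨y, hy, hpy⟩, -⟩
      simp only [insert_empty_eq, mem_singleton] at hx hy
      exact hpy (hy ▸ hx ▸ hpx)
    have hconnb : ¬ Separated (grid n) (insert b (insert a ∅)) :=
      not_separated_insert hconna (mem_insert_self _ _) (grid_adj.2 (.inr ⟨by omega, by omega⟩))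
    refine .intervalFamily_split (v := a) ((hU a).2 ha2.ge) ?_ ?_ ?_
    · intro S _ hSU hSk hS haS
      obtain ⟨p, hx, hy, hp⟩ := hS
      by_cases hvp : ∀ x ∈ S, ¬ p x → ¬ (grid n).Adj a x
      · exact exists_separated_insert_erase haS (by rw [card_empty]; omega) hy hp hvp
      by_cases hvp' : ∀ x ∈ S, p x → ¬ (grid n).Adj a x
      · refine exists_separated_insert_erase (p := fun x => ¬ p x) haS (by rw [card_empty]; omega)
          (by simpa using hx) ?_ (by simpa using hvp')
        intro x hx y hy hpx hpy hxy
        exact hp y hy x hx (not_not.1 hpy) hpx hxy.symm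
      -- Both neighbours of `a` are present, in different colours. The one to the right is
      -- exchanged for `a`; the other vertex of its column is adjacent to both, hence absent.
      push Not at hvp hvp'
      obtain ⟨c, hcS, hpc, hac⟩ := hvp
      obtain ⟨e, heS, hpe, hae⟩ := hvp'
      have hce : c ≠ e := fun h => hpc (h ▸ hpe)
      have hmid : ∀ x ∈ S, x ≠ b → m + 1 ≤ (x.2 : ℕ) := by
        intro x hx hxb
        rcases (hcolm x).1 ((hU x).1 (hSU hx)) with rfl | h | h
        exacts [absurd hx haS, absurd h hxb, h]
      have hnbr : ∀ x ∈ S, (grid n).Adj a x → x = b ∨ x.1 = 0 ∧ (x.2 : ℕ) = m + 1 := by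
        intro x hx hax
        by_cases hxb : x = b
        · exact .inl hxb
        have := hmid x hx hxb
        rw [grid_adj] at hax
        rcases hax with h | h
        · exact .inr ⟨by omega, by omega⟩
        · omega
      have hw : ∃ w ∈ S, w.1 = 0 ∧ (w.2 : ℕ) = m + 1 ∧ b ∈ S ∧
          (p w → ¬ p b) ∧ (¬ p w → p b) := by
        rcases hnbr c hcS hac with rfl | ⟨h1, h2⟩
        · rcases hnbr e heS hae with h | ⟨h1, h2⟩
          · exact absurd h.symm hce
          · exact ⟨e, heS, h1, h2, hcS, fun _ => hpc, fun h => absurd hpe h⟩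
        · rcases hnbr e heS hae with rfl | ⟨h1', h2'⟩
          · exact ⟨c, hcS, h1, h2, heS, fun h => absurd h hpc, fun _ => hpe⟩
          · exact absurd (vertex_eq (h1.trans h1'.symm) (h2.trans h2'.symm)) hce
      obtain ⟨w, hwS, hw1, hw2, hbS, hpwb, hpwb'⟩ := hw
      obtain ⟨y, hyS, hy⟩ := exists_mem_notMem_of_card_lt_card
        (by have := card_le_two (a := w) (b := b); omega : ({w, b} : Finset _).card < S.card)
      simp only [mem_insert, mem_singleton, not_or] at hy
      refine ⟨w, hwS, notMem_empty _, separated_of_column (m + 1)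
        ⟨a, mem_insert_self _ _, by omega⟩ ⟨y, by simp [hy.1, hyS], hmid y hyS hy.2⟩ ?_⟩
      intro s _ t ht _ _ htm
      have hta : t ≠ a := fun h => by rw [h] at htm; omega
      simp only [mem_insert, mem_erase, hta, false_or] at ht
      have ht1 : t.1 ≠ 0 := fun h => ht.1 (vertex_eq (h.trans hw1.symm) (by omega))
      have htw : (grid n).Adj t w := grid_adj.2 (.inr ⟨by omega, by omega⟩)
      have htb : (grid n).Adj t b := grid_adj.2 (.inl ⟨by omega, by omega⟩)
      by_cases hpt : p t
      · by_cases hpw : p w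
        · exact hp t ht.2 b hbS hpt (hpwb hpw) htb
        · exact hp t ht.2 w hwS hpt hpw htw
      · by_cases hpw : p w
        · exact hp w hwS t ht.2 hpw hpt htw.symm
        · exact hp b hbS t ht.2 (hpwb' hpw) hpt htb.symm
    · refine exchangeDecomposable_of_first_row hm (mem_insert_self _ _) ?_ ?_ hconna ?_ ?_ ?_
      · simpa using hab.symm
      · intro x hx
        simp only [insert_empty_eq, mem_singleton] at hx
        rw [hx]
      · intro x
        rw [hU, hcolm, insert_empty_eq, mem_singleton]
      · simpa using hk
      · refine exchangeDecomposable_of_both_rows (m := m + 1) (I := insert b (insert a ∅)) ?_ hconnb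
          ⟨a, by simp, ha1, by omega⟩ ⟨b, by simp, hb1, by omega⟩ ?_
        · intro x hx
          simp only [insert_empty_eq, mem_insert, mem_singleton] at hx
          rcases hx with rfl | rfl <;> omega
        · intro x
          rw [hU, hcolm]
          simp only [insert_empty_eq, mem_insert, mem_singleton]
          tauto
    have hU' : ∀ x, x ∈ U.erase a ↔ x = b ∨ m + 1 ≤ (x.2 : ℕ) := by
      intro x
      rw [mem_erase, hU, hcolm]
      constructor
      · tauto
      · rintro (rfl | h)
        · exact ⟨hab.symm, .inr (.inl rfl)⟩
        · exact ⟨fun h' => by rw [h'] at h; omega, .inr (.inr h)⟩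
    refine .intervalFamily_split (v := b) ((hU' b).2 (.inl rfl)) ?_ ?_ ?_
    · -- Without `a`, only one neighbour of `b` is left.
      intro S _ hSU hSk hS hbS
      have hnbr : ∀ x ∈ S, (grid n).Adj b x → x.1 = 1 ∧ (x.2 : ℕ) = m + 1 := by
        intro x hx hbx
        rcases (hU' x).1 (hSU hx) with rfl | h
        · exact absurd hx hbS
        rw [grid_adj] at hbx
        rcases hbx with h | h <;> omega
      obtain ⟨p, hx, hy, hp⟩ := hS
      by_cases hvp : ∀ x ∈ S, ¬ p x → ¬ (grid n).Adj b x
      · exact exists_separated_insert_erase hbS (by rw [card_empty]; omega) hy hp hvp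
      push Not at hvp
      obtain ⟨c, hcS, hpc, hbc⟩ := hvp
      refine exists_separated_insert_erase (p := fun x => ¬ p x) hbS (by rw [card_empty]; omega)
        (by simpa using hx) ?_ ?_
      · intro x hx y hy hpx hpy hxy
        exact hp y hy x hx (not_not.1 hpy) hpx hxy.symm
      · intro x hx hpx hbx
        have h1 := hnbr c hcS hbc
        have h2 := hnbr x hx hbx
        rw [vertex_eq (h2.1.trans h1.1.symm) (h2.2.trans h1.2.symm)] at hpx
        exact hpx hpc
    · refine exchangeDecomposable_of_single_row (m := m + 1) (i := 1) ⟨b, mem_insert_self _ _⟩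
        ?_ ?_ ?_
      · intro x hx
        simp only [insert_empty_eq, mem_singleton] at hx
        rw [hx]
        omega
      · intro x hx hxb
        exact ((hU' x).1 hx).resolve_left (by simpa using hxb)
      · intro x hx y _ hxy _ _
        simp only [insert_empty_eq, mem_singleton] at hx
        rw [← hxy, hx]
    · refine ih (m := m + 1) ?_ (by omega)
      intro x
      rw [mem_erase, hU']
      constructor
      · tauto
      · intro h
        exact ⟨fun h' => by rw [h'] at h; omega, .inr h⟩

theorem cutComplex_eq_avoidingComplex {V : Type*} [Fintype V] [DecidableEq V] (G : SimpleGraph V)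
    (k : ℕ) : cutComplex G k = avoidingComplex univ (intervalFamily (Separated G) k ∅ univ) := by
  ext σ
  change (∃ S : Finset V, S ⊆ σᶜ ∧ S.card = k ∧ ¬ (G.induce (S : Set V)).Preconnected) ↔
    σ ⊆ univ ∧ ∃ S ∈ intervalFamily (Separated G) k ∅ univ, Disjoint σ S
  simp only [mem_intervalFamily, not_preconnected_iff_separated, subset_univ, empty_subset,
    true_and]
  refine exists_congr fun S => ?_
  rw [subset_compl_iff_disjoint_left]
  tauto

/-- The vertex `(0, 0)` is isolated in any vertex set avoiding its two neighbours. -/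
theorem exists_separated_card (hk : 3 ≤ k) (hkn : k + 2 ≤ 2 * n) :
    ∃ S : Finset (Fin 2 × Fin n), S.card = k ∧ Separated (grid n) S := by
  obtain ⟨a, ha1, ha2⟩ : ∃ a : Fin 2 × Fin n, a.1 = 0 ∧ (a.2 : ℕ) = 0 :=
    ⟨(0, ⟨0, by omega⟩), rfl, rfl⟩
  obtain ⟨b, hb1, hb2⟩ : ∃ a : Fin 2 × Fin n, a.1 = 1 ∧ (a.2 : ℕ) = 0 :=
    ⟨(1, ⟨0, by omega⟩), rfl, rfl⟩
  obtain ⟨c, hc1, hc2⟩ : ∃ a : Fin 2 × Fin n, a.1 = 0 ∧ (a.2 : ℕ) = 1 :=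
    ⟨(0, ⟨1, by omega⟩), rfl, rfl⟩
  have hab : a ≠ b := fun h => by rw [h] at ha1; omega
  have hac : a ≠ c := fun h => by rw [h] at ha2; omega
  have hcard : k ≤ (({b, c} : Finset (Fin 2 × Fin n))ᶜ).card := by
    rw [card_compl, Fintype.card_prod, Fintype.card_fin, Fintype.card_fin]
    have := card_le_two (a := b) (b := c)
    omega
  obtain ⟨S, haS, hS, hSk⟩ := exists_subsuperset_card_eq
    (s := {a}) (t := ({b, c} : Finset (Fin 2 × Fin n))ᶜ)
    (by simp [hab, hac]) (by rw [card_singleton]; omega) hcard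
  obtain ⟨y, hyS, hya⟩ := exists_mem_ne (by omega : 1 < S.card) a
  refine ⟨S, hSk, fun x => x = a, ⟨a, singleton_subset_iff.1 haS, rfl⟩, ⟨y, hyS, hya⟩, ?_⟩
  rintro x - z hz rfl - hxz
  have hz' := hS hz
  simp only [mem_compl, mem_insert, mem_singleton, not_or] at hz'
  rw [grid_adj] at hxz
  rcases hxz with h | h
  · exact hz'.2 (vertex_eq (by omega) (by omega))
  · exact hz'.1 (vertex_eq (by omega) (by omega))

end Grid

end GridCut

theorem theorem5p6 (n k : ℕ) (hk : 3 ≤ k) (hkn : k + 2 ≤ 2 * n) :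
    (GridCut.cutComplex (GridCut.grid n) k).IsShellable ∧
      (GridCut.cutComplex (GridCut.grid n) k).IsRecursivelyShellable := by
  have h := GridCut.exchangeDecomposable_of_columns (n := n) (m := 0) (U := Finset.univ) hk
    (by simp)
  have hc : ∀ S ∈ GridCut.intervalFamily (GridCut.Separated (GridCut.grid n)) k ∅ Finset.univ,
      ∀ T ∈ GridCut.intervalFamily (GridCut.Separated (GridCut.grid n)) k ∅ Finset.univ,
      (Finset.univ \ S).card = (Finset.univ \ T).card := by
    intro S hS T hT
    rw [GridCut.mem_intervalFamily] at hS hT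
    rw [Finset.card_univ_sdiff, Finset.card_univ_sdiff, hS.1.2, hT.1.2]
  obtain ⟨S, hSk, hS⟩ := GridCut.exists_separated_card hk hkn
  rw [GridCut.cutComplex_eq_avoidingComplex]
  refine ⟨h.isShellable _ hc fun S _ => Finset.subset_univ S,
    h.isRecursivelyShellable _ ⟨S, ?_⟩ hc fun S _ T _ => ?_⟩
  · exact GridCut.mem_intervalFamily.2 ⟨⟨Finset.subset_univ _, hSk⟩, Finset.empty_subset _, hS⟩
  · rw [Finset.sdiff_eq_empty_iff_subset.2 (Finset.subset_univ S),
      Finset.sdiff_eq_empty_iff_subset.2 (Finset.subset_univ T)]
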